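/- Let $\mathcal{H}$ be a complex Hilbert space and $L(\mathcal{H})$ the algebra of bounded linear operators on $\mathcal{H}$, ordered by the cone of positive semidefinite operators. For $W \in L(\mathcal{H})$ with $W \ge 0$ and a closed subspace $\mathcal{S} \subseteq \mathcal{H}$, the \emph{shorted operator} $W_{/\mathcal{S}}$ is the maximum of the set $\{X \in L(\mathcal{H}) : 0 \le X \le W,\ R(X) \subseteq \mathcal{S}^{\perp}\}$ (this maximum always exists), where $R(X)$ denotes the range of $X$; the pair $(W,\mathcal{S})$ is \emph{compatible} if there exists $Q \in L(\mathcal{H})$ with $Q^2 = Q$, $R(Q) = \mathcal{S}$ and $WQ = Q^*W$. Let $A, W \in L(\mathcal{H})$, where $A$ has closed range and $W \ge 0$. Then there exists $X_0 \in L(\mathcal{H})$ such that $$W_{/R(A)} = (AX_0 - I)^* W (AX_0 - I)$$ if and only if the pair $(W, R(A))$ is compatible. -/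

import Mathlib

namespace ShortedOperator

open ContinuousLinearMap

/-- The set `M(W, S)` of all bounded operators `X` with `0 ≤ X ≤ W` (Loewner order, i.e. the order
induced by the cone of positive operators) and with range contained in the orthogonal complement
of `S`. -/
def shortedSet {H : Type*} [NormedAddCommGroup H] [InnerProductSpace ℂ H] [CompleteSpace H]
    (W : H →L[ℂ] H) (S : Submodule ℂ H) : Set (H →L[ℂ] H) :=
  {X | 0 ≤ X ∧ X ≤ W ∧ X.range ≤ Sᗮ}

/-- For a positive operator `W` the set `M(W, S)` has a maximum. -/
theorem exists_isGreatest_shortedSet {H : Type*} [NormedAddCommGroup H] [InnerProductSpace ℂ H]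
    [CompleteSpace H] (W : H →L[ℂ] H) (hW : 0 ≤ W) (S : Submodule ℂ H) :
    ∃ T : H →L[ℂ] H, IsGreatest (shortedSet W S) T := by
  set R : H →L[ℂ] H := CFC.sqrt W with hR
  have hRpos : R.IsPositive := (nonneg_iff_isPositive _).1 (CFC.sqrt_nonneg W)
  have hRR : ∀ x, R (R x) = W x := fun x => by
    have h := CFC.sqrt_mul_sqrt_self W hW
    exact congrArg (fun F : H →L[ℂ] H => F x) h
  have hRs : ∀ x y, inner ℂ (R x) y = inner ℂ x (R y) := hRpos.inner_left_eq_inner_right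
  let K : Submodule ℂ H := (S.map (R : H →ₗ[ℂ] H)).topologicalClosure
  have : CompleteSpace K := (Submodule.isClosed_topologicalClosure _).completeSpace_coe
  have hconj : ∀ U : H →L[ℂ] H, U.IsPositive → (R ∘L U ∘L R).IsPositive := fun U hU => by
    have h := hU.conj_adjoint R
    rwa [hRpos.isSelfAdjoint.adjoint_eq] at h
  have hP : ∀ U : Submodule ℂ H, ∀ [U.HasOrthogonalProjection], U.starProjection.IsPositive :=
    fun U _ => IsPositive.of_isStarProjection isStarProjection_starProjection
  have hTpos := hconj _ (hP Kᗮ)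
  have hTx : ∀ x, (R ∘L Kᗮ.starProjection ∘L R) x = R (R x - K.starProjection (R x)) := fun x => by
    simp [Submodule.starProjection_orthogonal_val]
  refine ⟨R ∘L Kᗮ.starProjection ∘L R, ⟨(nonneg_iff_isPositive _).2 hTpos, ?_, ?_⟩, ?_⟩
  · rw [le_def]
    convert! hconj _ (hP K) using 1
    ext x
    simp [hTx, hRR]
  · rintro _ ⟨x, rfl⟩
    rw [Submodule.mem_orthogonal']
    intro s hs
    have hm : R s ∈ K := Submodule.le_topologicalClosure _ ⟨s, hs, rfl⟩
    change inner ℂ ((R ∘L Kᗮ.starProjection ∘L R) x) s = 0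
    rw [hTx, hRs]
    exact K.starProjection_inner_eq_zero _ _ hm
  · rintro X ⟨hX0, hXW, hXS⟩
    have hX := (nonneg_iff_isPositive _).1 hX0
    rw [le_def] at hXW ⊢
    have hXs : ∀ s ∈ S, X s = 0 := fun s hs => by
      have h1 := (Submodule.mem_orthogonal' _ _).1 (hXS ⟨X s, rfl⟩) s hs
      change inner ℂ (X (X s)) s = 0 at h1
      rw [hX.inner_left_eq_inner_right] at h1
      exact inner_self_eq_zero.1 h1
    refine (isPositive_def' (𝕜 := ℂ)).2 ⟨hTpos.isSelfAdjoint.sub hX.isSelfAdjoint, fun x => ?_⟩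
    have key : ∀ k ∈ K, RCLike.re (inner ℂ (X x) x) ≤ ‖R x - k‖ ^ 2 := by
      have hcl : IsClosed {k : H | RCLike.re (inner ℂ (X x) x) ≤ ‖R x - k‖ ^ 2} :=
        isClosed_le continuous_const (by fun_prop)
      intro k hk
      refine closure_minimal ?_ hcl hk
      rintro _ ⟨s, hs, rfl⟩
      have h1 : inner ℂ (X x) x = inner ℂ (X (x - s)) (x - s) := by
        rw [hX.inner_left_eq_inner_right (x - s) (x - s), map_sub, hXs s hs, sub_zero,
          ← hX.inner_left_eq_inner_right, map_sub, hXs s hs, sub_zero]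
      have h2 := hXW.re_inner_nonneg_left (x - s)
      rw [sub_apply, inner_sub_left, ← hRR, hRs, map_sub, inner_self_eq_norm_sq, ← h1] at h2
      have h3 : R (x - s) = R x - R s := map_sub _ _ _
      rw [h3] at h2
      change _ ≤ ‖R x - R s‖ ^ 2
      linarith
    have h4 := key _ (K.starProjection_apply_mem (R x))
    have h5 : inner ℂ ((R ∘L Kᗮ.starProjection ∘L R) x) x =
        inner ℂ (R x - K.starProjection (R x)) (R x - K.starProjection (R x)) := by
      rw [hTx, hRs, inner_sub_right _ (R x),
        K.starProjection_inner_eq_zero _ _ (K.starProjection_apply_mem _), sub_zero]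
    rw [reApplyInnerSelf_apply, sub_apply, inner_sub_left, map_sub, h5, inner_self_eq_norm_sq]
    linarith

/-- The shorted operator of the positive operator `W` to the subspace `S`: the maximum of
`M(W, S)` (which is unique). -/
noncomputable def shorted {H : Type*} [NormedAddCommGroup H] [InnerProductSpace ℂ H]
    [CompleteSpace H] (W : H →L[ℂ] H) (hW : 0 ≤ W) (S : Submodule ℂ H) : H →L[ℂ] H :=
  Classical.choose (exists_isGreatest_shortedSet W hW S)

theorem isGreatest_shorted {H : Type*} [NormedAddCommGroup H] [InnerProductSpace ℂ H]
    [CompleteSpace H] (W : H →L[ℂ] H) (hW : 0 ≤ W) (S : Submodule ℂ H) :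
    IsGreatest (shortedSet W S) (shorted W hW S) :=
  Classical.choose_spec (exists_isGreatest_shortedSet W hW S)

/-- The pair `(W, S)` is compatible: there is a bounded, not necessarily self-adjoint, projection
`Q` with range `S` such that `W Q = Q* W`. -/
def Compatible {H : Type*} [NormedAddCommGroup H] [InnerProductSpace ℂ H] [CompleteSpace H]
    (W : H →L[ℂ] H) (S : Submodule ℂ H) : Prop :=
  ∃ Q : H →L[ℂ] H, Q * Q = Q ∧ Q.range = S ∧ W * Q = adjoint Q * W

end ShortedOperator

namespace ShortedOperator

open ContinuousLinearMap

section

variable {H : Type*} [NormedAddCommGroup H] [InnerProductSpace ℂ H] [CompleteSpace H]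

/-! Let `S = R(A)` and let `T` be the shorted operator; `T` is self-adjoint and vanishes on `S`. If
`T = (1 - B)* W (1 - B)` with `B = A X₀`, then at `u = (1 - B) x` the forms of `W` and `T` both
equal `⟨T x, x⟩`. Since `W - T ≥ 0`, this forces `W u = T u = T x`, so `W B = W - T` is self-adjoint
and agrees with `W` on `S`. Making `B` the identity on `S` then gives the required projection.
Conversely, for a `W`-self-adjoint projection `Q` onto `S`, every competitor `X` satisfies `X = (1 -
Q)* X (1 - Q) ≤ (1 - Q)* W (1 - Q)`, so the right side is the maximum; closedness of `R(A)` lets `Q`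
factor as `A X₀`. -/

/-- A positive operator annihilates every vector at which its quadratic form vanishes. -/
theorem apply_eq_zero_of_inner_self_eq_zero {D : H →L[ℂ] H} (hD : 0 ≤ D) {u : H}
    (hu : inner ℂ (D u) u = 0) : D u = 0 := by
  have hRpos : (CFC.sqrt D).IsPositive := (nonneg_iff_isPositive _).1 (CFC.sqrt_nonneg D)
  have hRR : CFC.sqrt D (CFC.sqrt D u) = D u :=
    congrArg (fun F : H →L[ℂ] H => F u) (CFC.sqrt_mul_sqrt_self D hD)
  rw [← hRR, hRpos.inner_left_eq_inner_right, inner_self_eq_zero] at hu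
  rw [← hRR, hu, map_zero]

/-- A positive operator whose range is orthogonal to `S` annihilates `S`. -/
theorem apply_eq_zero_of_range_le_orthogonal {X : H →L[ℂ] H} (hX : 0 ≤ X) {S : Submodule ℂ H}
    (hXS : X.range ≤ Sᗮ) {s : H} (hs : s ∈ S) : X s = 0 :=
  apply_eq_zero_of_inner_self_eq_zero hX ((Submodule.mem_orthogonal' _ _).1 (hXS ⟨s, rfl⟩) s hs)

/-- **Douglas factorization** through an operator with closed range. -/
theorem exists_mul_eq_of_range_le {A Q : H →L[ℂ] H} (hA : IsClosed (A.range : Set H))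
    (hQ : Q.range ≤ A.range) : ∃ X : H →L[ℂ] H, A * X = Q := by
  have : CompleteSpace A.ker := A.isClosed_ker.completeSpace_coe
  -- Restricted to `(ker A)ᗮ`, `A` is a bijection onto its closed range, so its inverse there is
  -- bounded.
  let g : A.kerᗮ →L[ℂ] H := A ∘L A.kerᗮ.subtypeL
  have hg : g.range = A.range := by
    refine le_antisymm ?_ ?_
    · rintro _ ⟨x, rfl⟩
      exact ⟨x, rfl⟩
    · rintro _ ⟨x, rfl⟩
      refine ⟨⟨x - A.ker.starProjection x, A.ker.sub_starProjection_mem_orthogonal x⟩, ?_⟩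
      have h : A (A.ker.starProjection x) = 0 := A.ker.starProjection_apply_mem x
      change A (x - A.ker.starProjection x) = A x
      rw [map_sub, h, sub_zero]
  have hinj : Function.Injective g := by
    refine (injective_iff_map_eq_zero g).2 fun x hx => Subtype.ext ?_
    exact (Submodule.mem_orthogonal _ _).1 x.2 x hx |> inner_self_eq_zero.1
  have hclo : IsClosed (Set.range g) := by
    have h : Set.range g = (A.range : Set H) := by rw [← hg]; rfl
    rwa [h]
  let e := g.equivRange hinj hclo
  let q : H →L[ℂ] g.range := Q.codRestrict g.range fun x => hg ▸ hQ ⟨x, rfl⟩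
  refine ⟨A.kerᗮ.subtypeL ∘L (e.symm : g.range →L[ℂ] A.kerᗮ) ∘L q, ?_⟩
  ext x
  have h : e (e.symm (q x)) = q x := e.apply_symm_apply _
  exact congrArg Subtype.val h

/-- If the shorted operator is `(1 - B)* W (1 - B)` with the range of `B` contained in `S`, then
it equals `W (1 - B)`. -/
theorem mul_one_sub_eq_shorted {B W : H →L[ℂ] H} (hW : 0 ≤ W) {S : Submodule ℂ H}
    (hB : B.range ≤ S) (h : shorted W hW S = adjoint (1 - B) * W * (1 - B)) :
    W * (1 - B) = shorted W hW S := by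
  obtain ⟨hT0, hTW, hTS⟩ := (isGreatest_shorted W hW S).1
  set T := shorted W hW S
  have hT := (nonneg_iff_isPositive T).1 hT0
  ext x
  have hTB : T (B x) = 0 := apply_eq_zero_of_range_le_orthogonal hT0 hTS (hB ⟨x, rfl⟩)
  have hTu : T (x - B x) = T x := by rw [map_sub, hTB, sub_zero]
  have hTx : T x = adjoint (1 - B) (W (x - B x)) := congrArg (fun F : H →L[ℂ] H => F x) h
  have h0 : (W - T) (x - B x) = 0 := by
    refine apply_eq_zero_of_inner_self_eq_zero (sub_nonneg.2 hTW) ?_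
    have h1 : inner ℂ (W (x - B x)) (x - B x) = inner ℂ (T x) x := by
      rw [hTx, adjoint_inner_left]
      rfl
    rw [sub_apply, inner_sub_left, h1, hTu, inner_sub_right, hT.inner_left_eq_inner_right x (B x),
      hTB, inner_zero_right, sub_zero, sub_self]
  rw [sub_apply, sub_eq_zero, hTu] at h0
  exact h0

/-- A `W`-self-adjoint projection onto `S` determines the shorted operator. -/
theorem shorted_eq_of_projection {W Q : H →L[ℂ] H} (hW : 0 ≤ W) {S : Submodule ℂ H}
    (hQQ : Q * Q = Q) (hQS : Q.range = S) (hWQ : W * Q = adjoint Q * W) :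
    shorted W hW S = adjoint (1 - Q) * W * (1 - Q) := by
  have hconj : ∀ {U V : H →L[ℂ] H}, U ≤ V → ∀ C : H →L[ℂ] H,
      adjoint C * U * C ≤ adjoint C * V * C := fun h C => star_left_conjugate_le_conjugate h C
  have hadj : adjoint (1 - Q) = 1 - adjoint Q := by
    rw [map_sub]
    exact congrArg (· - adjoint Q) (star_one (H →L[ℂ] H))
  have hQs : ∀ s ∈ S, Q s = s := by
    rintro s hs
    obtain ⟨y, rfl⟩ := hQS ▸ hs
    exact congrArg (fun F : H →L[ℂ] H => F y) hQQ
  have hWQQ : W * Q * Q = W * Q := by rw [mul_assoc, hQQ]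
  refine (isGreatest_shorted W hW S).unique ⟨⟨?_, ?_, ?_⟩, ?_⟩
  · simpa using hconj hW (1 - Q)
  -- All cross terms reduce to `W Q`, because `Q* W = W Q` and `Q² = Q`.
  · have h : W - adjoint (1 - Q) * W * (1 - Q) = adjoint Q * W * Q := by
      rw [hadj]
      simp only [sub_mul, mul_sub, one_mul, mul_one, ← hWQ, hWQQ]
      abel
    rw [← sub_nonneg, h]
    simpa using hconj hW Q
  · rintro _ ⟨x, rfl⟩
    refine (Submodule.mem_orthogonal' _ _).2 fun s hs => ?_
    change inner ℂ (adjoint (1 - Q) (W ((1 - Q) x))) s = 0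
    have h : (1 - Q) s = s - Q s := rfl
    rw [adjoint_inner_left, h, hQs s hs, sub_self, inner_zero_right]
  · rintro X ⟨hX0, hXW, hXS⟩
    have hXQ : X * Q = 0 := by
      ext x
      exact apply_eq_zero_of_range_le_orthogonal hX0 hXS (hQS ▸ ⟨x, rfl⟩)
    have hQX : adjoint Q * X = 0 := by
      have h := congrArg star hXQ
      rwa [star_mul, (IsSelfAdjoint.of_nonneg hX0).star_eq, star_zero] at h
    have h : adjoint (1 - Q) * X * (1 - Q) = X := by
      rw [hadj, sub_mul, one_mul, hQX, sub_zero, mul_sub, hXQ, mul_one, sub_zero]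
    rw [← h]
    exact hconj hXW _

/-- If `W B` is self-adjoint, `W B` agrees with `W` on the closed subspace `S` and the range of `B`
is contained in `S`, then `(W, S)` is compatible. -/
theorem compatible_of_mul_apply_eq {B W : H →L[ℂ] H} (hW : IsSelfAdjoint W) {S : Submodule ℂ H}
    (hS : IsClosed (S : Set H)) (hB : B.range ≤ S) (hWB : IsSelfAdjoint (W * B))
    (hWBs : ∀ s ∈ S, W (B s) = W s) : Compatible W S := by
  have : CompleteSpace S := hS.completeSpace_coe
  set P : H →L[ℂ] H := S.starProjection
  have hPs : ∀ s ∈ S, P s = s := fun s hs => Submodule.starProjection_eq_self_iff.2 hs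
  have hPm : ∀ x, P x ∈ S := fun x => S.starProjection_apply_mem x
  -- `B` need not fix `S`, so it is used only on `Sᗮ`. Replacing it by the identity on `S` does not
  -- change `W B`, as `W B = W` there.
  let Q : H →L[ℂ] H := P + B * (1 - P)
  have hQx : ∀ x, Q x = P x + B (x - P x) := fun x => rfl
  have hQm : ∀ x, Q x ∈ S := fun x => S.add_mem (hPm x) (hB ⟨_, rfl⟩)
  have hQs : ∀ s ∈ S, Q s = s := fun s hs => by rw [hQx, hPs s hs, sub_self, map_zero, add_zero]
  have hWQ : W * Q = W * B := by
    ext x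
    change W (Q x) = W (B x)
    rw [hQx, map_add, map_sub, map_sub, hWBs _ (hPm x)]
    abel
  refine ⟨Q, ext fun x => hQs _ (hQm x), le_antisymm ?_ fun s hs => ⟨s, hQs s hs⟩, ?_⟩
  · rintro _ ⟨x, rfl⟩
    exact hQm x
  · have h : star (W * Q) = W * Q := hWQ ▸ hWB
    rw [star_mul, hW.star_eq] at h
    exact h.symm

end

end ShortedOperator

theorem mainTheorem7 {H : Type*} [NormedAddCommGroup H] [InnerProductSpace ℂ H] [CompleteSpace H]
    (A W : H →L[ℂ] H) (hA : IsClosed (A.range : Set H)) (hW : 0 ≤ W) :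
    (∃ X₀ : H →L[ℂ] H,
        ShortedOperator.shorted W hW A.range =
          ContinuousLinearMap.adjoint (A * X₀ - 1) * W * (A * X₀ - 1)) ↔
      ShortedOperator.Compatible W A.range := by
  have hneg : ∀ X : H →L[ℂ] H,
      ContinuousLinearMap.adjoint (A * X - 1) * W * (A * X - 1) =
        ContinuousLinearMap.adjoint (1 - A * X) * W * (1 - A * X) := fun X => by
    rw [← neg_sub, map_neg, neg_mul, neg_mul_neg]
  constructor
  · rintro ⟨X₀, h⟩
    have hB : (A * X₀).range ≤ A.range := by
      rintro _ ⟨x, rfl⟩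
      exact ⟨X₀ x, rfl⟩
    have hT := ShortedOperator.mul_one_sub_eq_shorted hW hB (h.trans (hneg X₀))
    obtain ⟨hT0, -, hTS⟩ := (ShortedOperator.isGreatest_shorted W hW A.range).1
    have hWB : W * (A * X₀) = W - ShortedOperator.shorted W hW A.range := by
      rw [← hT, mul_sub, mul_one, sub_sub_cancel]
    refine ShortedOperator.compatible_of_mul_apply_eq (.of_nonneg hW) hA hB ?_ fun s hs => ?_
    · rw [hWB]
      exact (IsSelfAdjoint.of_nonneg hW).sub (.of_nonneg hT0)
    · refine (congrArg (fun F : H →L[ℂ] H => F s) hWB).trans ?_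
      rw [sub_apply,
        ShortedOperator.apply_eq_zero_of_range_le_orthogonal hT0 hTS hs, sub_zero]
  · rintro ⟨Q, hQQ, hQS, hWQ⟩
    obtain ⟨X₀, rfl⟩ := ShortedOperator.exists_mul_eq_of_range_le hA hQS.le
    exact ⟨X₀, (ShortedOperator.shorted_eq_of_projection hW hQQ hQS hWQ).trans (hneg X₀).symm⟩
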